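/- Let $L\ge 1$, let $P_0,\dots,P_L$ be probability distributions on a measurable space $\mathcal X$, and let $g:\mathcal X\to\{0,\dots,L\}$ be a (measurable) classifier. Put $\boldsymbol p_\vartheta[m]=P_\vartheta(g=m)$ and assume that $g$ is separable, i.e. $\boldsymbol p_\vartheta[\vartheta]>\boldsymbol p_\vartheta[m]$ for all $\vartheta\ne m$ in $\{0,\dots,L\}$. For $\theta\in\{1,\dots,L\}$ let $\Delta_\theta=\boldsymbol p_\theta[\theta]-\boldsymbol p_\theta[0]$, which is positive. Given observations $X_1,X_2,\dots$ and $1\le k\le n$, define the e-process started at time $k$ by $$W^{(k)}_n=\int_{-1}^0\prod_{t=k}^n\Bigl(1+\lambda\bigl(\mathbf 1_{g(X_t)=0}-\mathbf 1_{g(X_t)=\hat\jmath^{(k)}_t}\bigr)\Bigr)\,d\lambda ,$$ where $\hat\jmath^{(k)}_t$ maximizes over $m\in\{0,\dots,L\}$ the empirical frequency of the label $m$ among $g(X_k),\dots,g(X_{t-1})$ (all frequencies being $1/(L+1)$ if $t=k$), ties being broken by an arbitrary fixed deterministic rule depending on the vector of frequencies. Let $M_n=\max_{1\le k\le n}W^{(k)}_n$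 and, for $\alpha\in(0,1)$, let $\tau=\inf\{n\ge1: M_n\ge 1/\alpha\}\in\mathbb N\cup\{\infty\}$. Let $\mathbb E_\infty$ be the expectation when all $X_t$ are i.i.d. from $P_0$, and $\mathbb E_{T,\theta}$ the expectation when the $X_t$ are independent with $X_t\sim P_0$ for $t<T$ and $X_t\sim P_\theta$ for $t\ge T$. Let $\mathcal F_T^{(0)}=\sigma(g(X_t):1\le t\le T)$ and $$D=\sup_{T\in\mathbb N}\operatorname{ess\,sup}\mathbb E_{T,\theta}\bigl[(\tau-T)^+\mid\mathcal F^{(0)}_T\bigr].$$ Then: 1. $\mathbb E_\infty[\tau]\ge 1/\alpha$ for every $\alpha\in(0,1)$. 2. $D=\mathcal O\bigl(\log(1/(\alpha\Delta_\theta))/\Delta_\theta^2\bigr)$, in the following sense. For every $L\ge1$ and every $c\in(0,1)$ there is a constant $C$, depending only on $L$ and $c$, such that for all $\mathcal X$, $P_0,\dots,P_L$, $g$, $\theta\in\{1,\dots,L\}$, tie-breaking rules and $\alpha\in(0,1)$ as above with $\alpha\Delta_\theta\le c$, $$D\le C\,\frac{\log(1/(\alpha\Delta_\theta))}{\Delta_\theta^2}.$$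 Moreover, there is a universal constant $C$ such that, for all $L\ge 1$, all such $\mathcal X$, $P_0,\dots,P_L$, $g$, $\theta$, tie-breaking rules and every $\alpha\in(0,1)$, $$D\le C\Bigl(\frac{\log(1/(\alpha\Delta_\theta))}{\Delta_\theta^2}+L\Bigr).$$ -/

import Mathlib

open MeasureTheory
open scoped ENNReal

universe u

namespace ChangeDetection

variable {L : ℕ} {𝒳 : Type u} [MeasurableSpace 𝒳]

/-- The probability that the classifier `g` outputs label `m` on a sample drawn from `P θ`. -/
noncomputable def labelProb (P : Fin (L + 1) → Measure 𝒳) (g : 𝒳 → Fin (L + 1))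
    (θ m : Fin (L + 1)) : ℝ :=
  (P θ).real {x | g x = m}

/-- `g` is a separable classifier for the tuple `P`: under each `P θ`, the label `θ` is strictly
more likely than every other label. -/
def IsSeparable (P : Fin (L + 1) → Measure 𝒳) (g : 𝒳 → Fin (L + 1)) : Prop :=
  ∀ θ m : Fin (L + 1), m ≠ θ → labelProb P g θ m < labelProb P g θ θ

/-- The separation gap between the label `θ` and the label `0` under `P θ`. -/
noncomputable def gap (P : Fin (L + 1) → Measure 𝒳) (g : 𝒳 → Fin (L + 1))
    (θ : Fin (L + 1)) : ℝ :=
  labelProb P g θ θ - labelProb P g θ 0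

/-- A deterministic rule selecting a maximizing coordinate of a real vector: an `argmax` together
with a way of breaking ties. -/
def IsArgmaxRule (sel : (Fin (L + 1) → ℝ) → Fin (L + 1)) : Prop :=
  ∀ (v : Fin (L + 1) → ℝ) (m : Fin (L + 1)), v m ≤ v (sel v)

/-- The empirical label frequencies of the samples `X_k, …, X_{t-1}`, that is, those that a test
started at time `k` has seen before time `t`; it is the uniform vector if there are none. A path
`ω : ℕ → 𝒳` gives the observations `X_t = ω t`, of which only those with `t ≥ 1` are used. -/
noncomputable def empirical (g : 𝒳 → Fin (L + 1)) (k t : ℕ) (ω : ℕ → 𝒳) :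
    Fin (L + 1) → ℝ := fun m =>
  if t ≤ k then 1 / ((L : ℝ) + 1)
  else ((Finset.Ico k t).filter (fun s => g (ω s) = m)).card / ((t : ℝ) - (k : ℝ))

/-- The label on which a test started at time `k` bets at time `t`. -/
noncomputable def betLabel (g : 𝒳 → Fin (L + 1)) (sel : (Fin (L + 1) → ℝ) → Fin (L + 1))
    (k t : ℕ) (ω : ℕ → 𝒳) : Fin (L + 1) :=
  sel (empirical g k t ω)

/-- The e-process started at time `k`, at time `n`. -/
noncomputable def wealth (g : 𝒳 → Fin (L + 1)) (sel : (Fin (L + 1) → ℝ) → Fin (L + 1))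
    (k n : ℕ) (ω : ℕ → 𝒳) : ℝ :=
  ∫ l in (-1 : ℝ)..0, ∏ t ∈ Finset.Icc k n,
    (1 + l * ((if g (ω t) = 0 then 1 else 0) -
      (if g (ω t) = betLabel g sel k t ω then 1 else 0)))

/-- The e-detector at time `n ≥ 1`: the largest value at time `n` of the e-processes started at the
times `1, …, n` (set to `0` at the unused time `n = 0`). -/
noncomputable def eDetector (g : 𝒳 → Fin (L + 1)) (sel : (Fin (L + 1) → ℝ) → Fin (L + 1))
    (n : ℕ) (ω : ℕ → 𝒳) : ℝ :=
  if h : 1 ≤ n then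
    (Finset.Icc 1 n).sup' (Finset.nonempty_Icc.mpr h) (fun k => wealth g sel k n ω)
  else 0

/-- The first time `n ≥ 1` at which the e-detector is at least `1 / α` (`⊤` if there is none). -/
noncomputable def stopTime (g : 𝒳 → Fin (L + 1)) (sel : (Fin (L + 1) → ℝ) → Fin (L + 1))
    (α : ℝ) (ω : ℕ → 𝒳) : ℕ∞ :=
  sInf {N : ℕ∞ | ∃ n : ℕ, N = (n : ℕ∞) ∧ 1 ≤ n ∧ 1 / α ≤ eDetector g sel n ω}

/-- The law of an independent sequence with `X_t ∼ P 0` for `t < T` and `X_t ∼ P θ` for `t ≥ T`. -/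
noncomputable def changeLaw (P : Fin (L + 1) → Measure 𝒳) (θ : Fin (L + 1)) (T : ℕ) :
    Measure (ℕ → 𝒳) :=
  Measure.infinitePi (fun t : ℕ => if t < T then P 0 else P θ)

/-- The σ-algebra generated by the classifier outputs `g(X_1), …, g(X_T)`. -/
abbrev outputSigma (g : 𝒳 → Fin (L + 1)) (T : ℕ) : MeasurableSpace (ℕ → 𝒳) :=
  ⨆ t ∈ Finset.Icc 1 T, MeasurableSpace.comap (fun ω : ℕ → 𝒳 => g (ω t)) ⊤

/-- The expected time of a false alarm: the expectation of the stopping time if no change occurs. -/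
noncomputable def runLength (P : Fin (L + 1) → Measure 𝒳) (g : 𝒳 → Fin (L + 1))
    (sel : (Fin (L + 1) → ℝ) → Fin (L + 1)) (α : ℝ) : ℝ≥0∞ :=
  ∫⁻ ω, (stopTime g sel α ω : ℝ≥0∞) ∂(Measure.infinitePi (fun _ : ℕ => P 0))

/-- The worst-case conditional detection delay
`sup_T ess sup E_{T,θ}[(τ - T)^+ | σ(g(X_1), …, g(X_T))]`, with values in `[0, ∞]`. -/
noncomputable def worstDelay (P : Fin (L + 1) → Measure 𝒳) (g : 𝒳 → Fin (L + 1))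
    (sel : (Fin (L + 1) → ℝ) → Fin (L + 1)) (α : ℝ) (θ : Fin (L + 1)) : ℝ≥0∞ :=
  ⨆ T : ℕ, essSup
    (condLExp (outputSigma g T) (changeLaw P θ T)
      (fun ω => ((stopTime g sel α ω - (T : ℕ∞) : ℕ∞) : ℝ≥0∞)))
    (changeLaw P θ T)

end ChangeDetection

/-! False alarms. Under `P 0` a bet has mean factor `1 + λ (p 0 - p j) ≤ 1`, since `λ ≤ 0` and label
`0` is the most likely one. So each e-process is a nonnegative supermartingale started from `1`, and
the sum over `k ≤ n` of the e-processes, minus `n`, is a supermartingale. That sum dominates the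
e-detector, so it is at least `1/α` at the stopping time, and optional stopping gives `E τ ≥ 1/α`
(`ofReal_le_lintegral_stopTime`).

Delay. Only the test started at `T + 1` is used. It is a function of labels independent of `g(X_1),
…, g(X_T)`, so conditioning has no effect and the delay is bounded by a tail sum of `P(W < 1/α)`
(`condLExp_stopTime_sub_le`). The leading label need not be `θ`. By Hoeffding its probability is
close to that of `θ`, with errors of order `1/√i` after `i` samples, so only the gap `Δ` between `θ`
and `0` matters. The bets thus gain at least `nΔ/4` outside an event of probability of order `(L+1)
n exp(-nΔ²/128)` (`measure_sum_betGain_lt_le`), and then the values of `λ` of order `-Δ` alone make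
the wealth exponentially large in `nΔ²` (`wealth_ge`).

Summing the tails gives a delay of order `log((L+1)/(αΔ²))/Δ²`. The `log(L+1)` of the union bound is
traded for an additive `L` in `one_add_log_div_sq_le`. -/

namespace ChangeDetection

/-! ### Functions of finitely many labels, independence and concentration -/

section Labels

variable {Ω κ : Type*}

/-- `F` is a function of the labels `Y i`, `i ∈ S`. -/
def LabelDetermined {β : Type*} (Y : ℕ → Ω → κ) (S : Finset ℕ) (F : Ω → β) : Prop :=
  ∀ ω ω' : Ω, (∀ i ∈ S, Y i ω = Y i ω') → F ω = F ω'

theorem LabelDetermined.comp {β γ : Type*} {Y : ℕ → Ω → κ} {S : Finset ℕ} {F : Ω → β}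
    (hF : LabelDetermined Y S F) (f : β → γ) : LabelDetermined Y S (fun ω => f (F ω)) :=
  fun ω ω' h => congrArg f (hF ω ω' h)

variable [MeasurableSpace κ]

/-- The σ-algebra generated by the labels with index in `S`. -/
abbrev labelSigma (Y : ℕ → Ω → κ) (S : Set ℕ) : MeasurableSpace Ω :=
  ⨆ t ∈ S, MeasurableSpace.comap (Y t) inferInstance

theorem LabelDetermined.measurable_labelSigma [Finite κ] [DiscreteMeasurableSpace κ]
    {β : Type*} [MeasurableSpace β] {Y : ℕ → Ω → κ} {S : Finset ℕ} {F : Ω → β}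
    (hF : LabelDetermined Y S F) : Measurable[labelSigma Y S] F := by
  intro A _
  let r : Ω → (S → κ) := fun ω i => Y i ω
  have hr : Measurable[labelSigma Y S] r := by
    refine @measurable_pi_lambda _ _ _ (labelSigma Y S) _ _ fun i => ?_
    refine Measurable.mono (comap_measurable (Y i)) ?_ le_rfl
    exact le_iSup₂_of_le (f := fun t (_ : t ∈ (S : Set ℕ)) =>
      MeasurableSpace.comap (Y t) inferInstance) i.1 i.2 le_rfl
  -- `F` is constant on the fibres of `r`, and every subset of the finite discrete space of label
  -- tuples is measurable; so nothing is asked of `A`.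
  have : F ⁻¹' A = r ⁻¹' (r '' (F ⁻¹' A)) := by
    refine Set.Subset.antisymm (Set.subset_preimage_image _ _) ?_
    rintro ω ⟨ω', hω', h⟩
    have : F ω' = F ω := hF ω' ω fun i hi => congrFun h ⟨i, hi⟩
    simpa [← this] using hω'
  rw [this]
  exact hr (Set.toFinite _).measurableSet

variable [MeasurableSpace Ω]

theorem labelSigma_le {Y : ℕ → Ω → κ} (hY : ∀ t, Measurable (Y t)) (S : Set ℕ) :
    labelSigma Y S ≤ ‹MeasurableSpace Ω› :=
  iSup₂_le fun t _ => (hY t).comap_le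

theorem LabelDetermined.measurable [Finite κ] [DiscreteMeasurableSpace κ]
    {β : Type*} [MeasurableSpace β] {Y : ℕ → Ω → κ} (hY : ∀ t, Measurable (Y t))
    {S : Finset ℕ} {F : Ω → β} (hF : LabelDetermined Y S F) : Measurable F :=
  hF.measurable_labelSigma.mono (labelSigma_le hY _) le_rfl

theorem indep_labelSigma {μ : Measure Ω} {Y : ℕ → Ω → κ} (hY : ∀ t, Measurable (Y t))
    (hind : ProbabilityTheory.iIndepFun Y μ) {S S' : Set ℕ} (hS : Disjoint S S') :
    ProbabilityTheory.Indep (labelSigma Y S) (labelSigma Y S') μ :=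
  ProbabilityTheory.indep_iSup_of_disjoint (fun t => (hY t).comap_le) hind hS

variable [Fintype κ] [DiscreteMeasurableSpace κ]

/-- Averaging over the label at time `n`, which is independent of the labels in `S`. -/
theorem lintegral_label_eq_sum {μ : Measure Ω} {Y : ℕ → Ω → κ} (hY : ∀ t, Measurable (Y t))
    (hind : ProbabilityTheory.iIndepFun Y μ) {S : Finset ℕ} {n : ℕ} (hn : n ∉ S)
    {F : Ω → κ → ℝ≥0∞} (hF : ∀ y, LabelDetermined Y S fun ω => F ω y) :
    ∫⁻ ω, F ω (Y n ω) ∂μ = ∫⁻ ω, ∑ y, μ (Y n ⁻¹' {y}) * F ω y ∂μ := by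
  classical
  have hFm : ∀ y, Measurable fun ω => F ω y := fun y => (hF y).measurable hY
  have hs : ∀ y, MeasurableSet (Y n ⁻¹' {y}) := fun y => hY n (measurableSet_singleton y)
  have h1 : ∀ ω, F ω (Y n ω) = ∑ y, (Y n ⁻¹' {y}).indicator (fun _ => 1) ω * F ω y := by
    intro ω
    rw [Finset.sum_eq_single (Y n ω)] <;> simp +contextual [Set.indicator, eq_comm]
  simp_rw [h1]
  rw [lintegral_finsetSum _ fun y _ => by
      exact (measurable_const.indicator (hs y)).mul (hFm y),
    lintegral_finsetSum _ fun y _ => (hFm y).const_mul _]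
  refine Finset.sum_congr rfl fun y _ => ?_
  have hdis : Disjoint ({n} : Set ℕ) (S : Set ℕ) := by simpa using hn
  have hm : Measurable[labelSigma Y {n}] ((Y n ⁻¹' {y}).indicator fun _ => (1 : ℝ≥0∞)) := by
    have e : labelSigma Y {n} = MeasurableSpace.comap (Y n) inferInstance := by simp [labelSigma]
    have : Measurable[labelSigma Y {n}] (Y n) := by
      rw [e]
      exact comap_measurable (Y n)
    exact measurable_const.indicator (this (measurableSet_singleton y))
  have := ProbabilityTheory.lintegral_mul_eq_lintegral_mul_lintegral_of_independent_measurableSpace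
    (labelSigma_le hY _) (labelSigma_le hY _) (indep_labelSigma hY hind hdis) hm
    (hF y).measurable_labelSigma
  rw [this, lintegral_const_mul _ (hFm y), lintegral_indicator (hs y)]
  simp

/-- Each factor has conditional mean at most one given the past, so the product is a
supermartingale: average over the last label and induct. -/
theorem lintegral_prod_le_one {μ : Measure Ω} [IsProbabilityMeasure μ] {Y : ℕ → Ω → κ}
    (hY : ∀ t, Measurable (Y t)) (hind : ProbabilityTheory.iIndepFun Y μ)
    (U : ℕ → Ω → κ → ℝ≥0∞) (k n : ℕ)
    (hU : ∀ t y, LabelDetermined Y (Finset.Ico k t) fun ω => U t ω y)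
    (hle : ∀ t, k ≤ t → ∀ ω, ∑ y, μ (Y t ⁻¹' {y}) * U t ω y ≤ 1) :
    ∫⁻ ω, ∏ i ∈ Finset.range n, U (k + i) ω (Y (k + i) ω) ∂μ ≤ 1 := by
  induction n with
  | zero => simp
  | succ n ih =>
    simp_rw [Finset.prod_range_succ]
    have hdet : ∀ y, LabelDetermined Y (Finset.Ico k (k + n)) fun ω =>
        (∏ i ∈ Finset.range n, U (k + i) ω (Y (k + i) ω)) * U (k + n) ω y := by
      intro y ω ω' h
      have hprod : ∀ i ∈ Finset.range n,
          U (k + i) ω (Y (k + i) ω) = U (k + i) ω' (Y (k + i) ω') := by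
        intro i hi
        have hi := Finset.mem_range.mp hi
        rw [← h (k + i) (by simp [hi])]
        exact hU (k + i) _ ω ω' fun j hj => h j (by simp at hj ⊢; omega)
      simp only
      rw [Finset.prod_congr rfl hprod]
      congr 1
      exact hU (k + n) y ω ω' h
    rw [lintegral_label_eq_sum hY hind (n := k + n) (by simp) hdet]
    refine le_trans (lintegral_mono fun ω => ?_) ih
    calc ∑ y, μ (Y (k + n) ⁻¹' {y}) *
          ((∏ i ∈ Finset.range n, U (k + i) ω (Y (k + i) ω)) * U (k + n) ω y)
        = (∏ i ∈ Finset.range n, U (k + i) ω (Y (k + i) ω)) *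
          ∑ y, μ (Y (k + n) ⁻¹' {y}) * U (k + n) ω y := by
          rw [Finset.mul_sum]; exact Finset.sum_congr rfl fun y _ => by ring
      _ ≤ _ := mul_le_of_le_one_right zero_le (hle _ (by omega) ω)


/-- Hoeffding's lemma for a function on a finite probability space with values in `[-1, 1]`. -/
theorem sum_mul_exp_le_exp (ν : Measure κ) [IsProbabilityMeasure ν] {f : κ → ℝ}
    (hf : ∀ y, f y ∈ Set.Icc (-1 : ℝ) 1) (s : ℝ) :
    ∑ y, ν.real {y} * Real.exp (s * (f y - ∑ z, ν.real {z} * f z)) ≤ Real.exp (s ^ 2 / 2) := by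
  have h := (ProbabilityTheory.hasSubgaussianMGF_of_mem_Icc (μ := ν) (X := f)
    (Measurable.of_discrete.aemeasurable) (ae_of_all _ hf)).mgf_le s
  rw [ProbabilityTheory.mgf, integral_fintype (Integrable.of_finite),
    integral_fintype (Integrable.of_finite)] at h
  simp only [smul_eq_mul] at h
  refine h.trans (le_of_eq ?_)
  have : ‖(1 : ℝ) - -1‖₊ = 2 := by
    rw [← NNReal.coe_inj]; norm_num
  rw [this]
  norm_num

/-- The Azuma-Hoeffding inequality for sums of predictably chosen functions of the labels. -/
theorem measure_sum_le_sub_le {μ : Measure Ω} [IsProbabilityMeasure μ] {Y : ℕ → Ω → κ}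
    (hY : ∀ t, Measurable (Y t)) (hind : ProbabilityTheory.iIndepFun Y μ) {p : κ → ℝ} {k : ℕ}
    (hp : ∀ t, k ≤ t → ∀ y, μ.real (Y t ⁻¹' {y}) = p y) {f : ℕ → Ω → κ → ℝ}
    (hf : ∀ t ω y, f t ω y ∈ Set.Icc (-1 : ℝ) 1)
    (hdet : ∀ t y, LabelDetermined Y (Finset.Ico k t) fun ω => f t ω y) (n : ℕ) {ε : ℝ}
    (hε : 0 ≤ ε) :
    μ {ω | ∑ i ∈ Finset.range n, f (k + i) ω (Y (k + i) ω) ≤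
        (∑ i ∈ Finset.range n, ∑ y, p y * f (k + i) ω y) - n * ε} ≤
      ENNReal.ofReal (Real.exp (-(n * ε ^ 2 / 2))) := by
  -- Chernoff tilt at `-ε`; subtracting `ε²/2` makes each conditional mean at most one by
  -- Hoeffding's lemma.
  set d : ℕ → Ω → κ → ℝ := fun t ω y =>
    Real.exp (-ε * (f t ω y - ∑ z, p z * f t ω z) - ε ^ 2 / 2) with hd
  set U : ℕ → Ω → κ → ℝ≥0∞ := fun t ω y => ENNReal.ofReal (d t ω y) with hUdef
  have hUdet : ∀ t y, LabelDetermined Y (Finset.Ico k t) fun ω => U t ω y := by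
    intro t y ω ω' h
    have := fun y => hdet t y ω ω' h
    simp only at this
    simp [hUdef, hd, this]
  have hpn : ∀ y, 0 ≤ p y := fun y => by rw [← hp k le_rfl y]; exact measureReal_nonneg
  have hUle : ∀ t, k ≤ t → ∀ ω, ∑ y, μ (Y t ⁻¹' {y}) * U t ω y ≤ 1 := by
    intro t ht ω
    have hν : IsProbabilityMeasure (μ.map (Y t)) :=
      Measure.isProbabilityMeasure_map (hY t).aemeasurable
    have hνp : ∀ y, (μ.map (Y t)).real {y} = p y := fun y => by
      rw [map_measureReal_apply (hY t) (measurableSet_singleton y), hp t ht]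
    have hoef := sum_mul_exp_le_exp (μ.map (Y t)) (hf t ω) (-ε)
    simp only [hνp] at hoef
    have hμ : ∀ y, μ (Y t ⁻¹' {y}) = ENNReal.ofReal (p y) := fun y => by
      rw [← hp t ht y, ofReal_measureReal]
    simp only [hμ, hUdef]
    have : ∀ y, ENNReal.ofReal (p y) * ENNReal.ofReal (d t ω y) =
        ENNReal.ofReal (p y * d t ω y) := fun y => (ENNReal.ofReal_mul (hpn y)).symm
    simp only [this]
    rw [← ENNReal.ofReal_sum_of_nonneg fun y _ => mul_nonneg (hpn y) (Real.exp_pos _).le,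
      ENNReal.ofReal_le_one]
    have hfac : ∑ y, p y * d t ω y = (∑ y, p y * Real.exp (-ε * (f t ω y - ∑ z, p z * f t ω z))) *
        Real.exp (-(ε ^ 2 / 2)) := by
      rw [Finset.sum_mul]
      refine Finset.sum_congr rfl fun y _ => ?_
      simp only [hd, mul_assoc, ← Real.exp_add, sub_eq_add_neg]
    rw [hfac]
    calc _ ≤ Real.exp ((-ε) ^ 2 / 2) * Real.exp (-(ε ^ 2 / 2)) := by gcongr
      _ = 1 := by rw [← Real.exp_add]; simp
  have hint := lintegral_prod_le_one hY hind U k n hUdet hUle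
  have hmeas : Measurable fun ω => ∏ i ∈ Finset.range n, U (k + i) ω (Y (k + i) ω) := by
    refine Finset.measurable_prod _ fun i _ => ?_
    refine LabelDetermined.measurable hY (S := Finset.Icc k (k + i)) ?_
    intro ω ω' h
    simp only
    rw [← h (k + i) (by simp)]
    exact hUdet (k + i) _ ω ω' fun j hj => h j (by simp at hj ⊢; omega)
  -- A shortfall of `nε` puts the log of the product at `nε² - nε²/2` or more, and Markov's
  -- inequality applies.
  have hsub : {ω | ∑ i ∈ Finset.range n, f (k + i) ω (Y (k + i) ω) ≤
        (∑ i ∈ Finset.range n, ∑ y, p y * f (k + i) ω y) - n * ε} ⊆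
      {ω | ENNReal.ofReal (Real.exp (n * ε ^ 2 / 2)) ≤
        ∏ i ∈ Finset.range n, U (k + i) ω (Y (k + i) ω)} := by
    intro ω hω
    simp only [Set.mem_ofPred_eq, hUdef, hd] at hω ⊢
    rw [← ENNReal.ofReal_prod_of_nonneg fun i _ => (Real.exp_pos _).le, ← Real.exp_sum]
    refine ENNReal.ofReal_le_ofReal (Real.exp_le_exp.mpr ?_)
    rw [Finset.sum_sub_distrib, ← Finset.mul_sum, Finset.sum_sub_distrib, Finset.sum_const,
      Finset.card_range, nsmul_eq_mul]
    nlinarith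
  have hpos : 0 < Real.exp (n * ε ^ 2 / 2) := Real.exp_pos _
  have hmarkov := mul_meas_ge_le_lintegral (μ := μ) hmeas
    (ENNReal.ofReal (Real.exp (n * ε ^ 2 / 2)))
  calc _ ≤ μ {ω | ENNReal.ofReal (Real.exp (n * ε ^ 2 / 2)) ≤
        ∏ i ∈ Finset.range n, U (k + i) ω (Y (k + i) ω)} := measure_mono hsub
    _ ≤ (ENNReal.ofReal (Real.exp (n * ε ^ 2 / 2)))⁻¹ := by
      rw [ENNReal.le_inv_iff_mul_le, mul_comm]
      exact hmarkov.trans hint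
    _ = _ := by rw [← ENNReal.ofReal_inv_of_pos hpos, ← Real.exp_neg]

end Labels

/-! ### The e-detector and the false alarm bound -/

section Detector

variable {L : ℕ} {𝒳 : Type u} {g : 𝒳 → Fin (L + 1)}
  {sel : (Fin (L + 1) → ℝ) → Fin (L + 1)}

/-- The label of the observation at time `t`. -/
def pathLabel (g : 𝒳 → Fin (L + 1)) (t : ℕ) (ω : ℕ → 𝒳) : Fin (L + 1) := g (ω t)

theorem labelDetermined_empirical (k t : ℕ) :
    LabelDetermined (pathLabel g) (Finset.Ico k t) (empirical g k t) := by
  intro ω ω' h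
  funext m
  have : (Finset.Ico k t).filter (fun s => g (ω s) = m) =
      (Finset.Ico k t).filter (fun s => g (ω' s) = m) :=
    Finset.filter_congr fun i hi => by rw [show g (ω i) = g (ω' i) from h i hi]
  simp only [empirical, this]

theorem labelDetermined_betLabel (k t : ℕ) :
    LabelDetermined (pathLabel g) (Finset.Ico k t) (betLabel g sel k t) :=
  (labelDetermined_empirical k t).comp sel

/-- The net gain of the bet placed at time `t` when the label is `y`. -/
noncomputable def betGain (g : 𝒳 → Fin (L + 1)) (sel : (Fin (L + 1) → ℝ) → Fin (L + 1))
    (k t : ℕ) (ω : ℕ → 𝒳) (y : Fin (L + 1)) : ℝ :=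
  (if y = betLabel g sel k t ω then 1 else 0) - (if y = 0 then 1 else 0)

theorem labelDetermined_betGain (k t : ℕ) (y : Fin (L + 1)) :
    LabelDetermined (pathLabel g) (Finset.Ico k t) fun ω => betGain g sel k t ω y :=
  (labelDetermined_betLabel k t).comp fun j =>
    ((if y = j then 1 else 0) - (if y = 0 then 1 else 0) : ℝ)

theorem betGain_mem_Icc (k t : ℕ) (ω : ℕ → 𝒳) (y : Fin (L + 1)) :
    betGain g sel k t ω y ∈ Set.Icc (-1 : ℝ) 1 := by
  unfold betGain
  constructor <;> split_ifs <;> norm_num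

theorem wealth_eq (k n : ℕ) (ω : ℕ → 𝒳) :
    wealth g sel k n ω = ∫ l in (-1 : ℝ)..0, ∏ t ∈ Finset.Icc k n,
      (1 - l * betGain g sel k t ω (pathLabel g t ω)) := by
  unfold wealth betGain pathLabel
  congr 1
  funext l
  refine Finset.prod_congr rfl fun t _ => ?_
  ring

theorem one_sub_mul_betGain_nonneg {l : ℝ} (hl : l ∈ Set.Icc (-1 : ℝ) 0) (k t : ℕ) (ω : ℕ → 𝒳)
    (y : Fin (L + 1)) : 0 ≤ 1 - l * betGain g sel k t ω y := by
  have h := betGain_mem_Icc (g := g) (sel := sel) k t ω y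
  nlinarith [hl.1, hl.2, h.1, h.2]


theorem labelDetermined_wealth (k n : ℕ) :
    LabelDetermined (pathLabel g) (Finset.Icc k n) (wealth g sel k n) := by
  intro ω ω' h
  rw [wealth_eq, wealth_eq]
  congr 1
  funext l
  refine Finset.prod_congr rfl fun t ht => ?_
  have ht' := Finset.mem_Icc.mp ht
  rw [← h t ht, show betGain g sel k t ω _ = betGain g sel k t ω' _ from
    labelDetermined_betGain k t _ ω ω' fun i hi => h i (by simp at hi ⊢; omega)]

/-- The empty product is integrated over an interval of length one. This is the starting capital of
the test launched at time `n + 1`. -/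
theorem wealth_of_lt {k n : ℕ} (h : n < k) (ω : ℕ → 𝒳) : wealth g sel k n ω = 1 := by
  simp [wealth, Finset.Icc_eq_empty_of_lt h]

theorem wealth_le_eDetector {k n : ℕ} (hk : 1 ≤ k) (hkn : k ≤ n) (ω : ℕ → 𝒳) :
    wealth g sel k n ω ≤ eDetector g sel n ω := by
  rw [eDetector, dif_pos (hk.trans hkn)]
  exact Finset.le_sup' (fun k => wealth g sel k n ω) (Finset.mem_Icc.mpr ⟨hk, hkn⟩)

theorem labelDetermined_eDetector (n : ℕ) :
    LabelDetermined (pathLabel g) (Finset.Icc 1 n) (eDetector g sel n) := by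
  intro ω ω' h
  unfold eDetector
  split_ifs with hn
  · refine Finset.sup'_congr _ rfl fun k hk => ?_
    refine labelDetermined_wealth k n ω ω' fun i hi => h i ?_
    simp at hk hi ⊢
    omega
  · rfl

theorem lt_stopTime_iff {α : ℝ} {n : ℕ} {ω : ℕ → 𝒳} :
    (n : ℕ∞) < stopTime g sel α ω ↔
      ∀ m, 1 ≤ m → m ≤ n → eDetector g sel m ω < 1 / α := by
  constructor
  · intro h m hm hmn
    by_contra! hc
    have : stopTime g sel α ω ≤ m := sInf_le ⟨m, rfl, hm, hc⟩
    exact absurd (h.trans_le this) (by simpa using hmn)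
  · intro h
    rw [← ENat.add_one_le_iff (ENat.natCast_ne_top n)]
    refine le_sInf ?_
    rintro _ ⟨m, rfl, hm, hc⟩
    have : n < m := by
      by_contra! hmn
      exact absurd (h m hm hmn) (not_lt.mpr hc)
    exact_mod_cast this

theorem labelDetermined_lt_stopTime (α : ℝ) (n : ℕ) :
    LabelDetermined (pathLabel g) (Finset.Icc 1 n)
      fun ω => (n : ℕ∞) < stopTime g sel α ω := by
  intro ω ω' h
  simp only [lt_stopTime_iff, eq_iff_iff]
  refine forall_congr' fun m => forall_congr' fun hm => forall_congr' fun hmn => ?_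
  rw [labelDetermined_eDetector m ω ω' fun i hi => h i (by simp at hi ⊢; omega)]

/-- Pointwise tail-sum formula, which reduces `E τ` to the probabilities of `n < τ`. -/
theorem tsum_lt_eq_coe (m : ℕ∞) :
    ∑' n : ℕ, (if (n : ℕ∞) < m then 1 else 0 : ℝ≥0∞) = m := by
  cases m with
  | top => simp
  | coe k =>
    rw [tsum_eq_sum (s := Finset.range k) (by simp +contextual)]
    simp only [Nat.cast_lt]
    rw [Finset.sum_congr rfl (g := fun _ => 1) fun i hi => if_pos (Finset.mem_range.mp hi)]
    simp

/-- The wealth at time `n` if the label at time `n` is replaced by `y`. -/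
noncomputable def wealthStep (g : 𝒳 → Fin (L + 1)) (sel : (Fin (L + 1) → ℝ) → Fin (L + 1))
    (k n : ℕ) (ω : ℕ → 𝒳) (y : Fin (L + 1)) : ℝ :=
  ∫ l in (-1 : ℝ)..0, (∏ t ∈ Finset.Icc k n,
    (1 - l * betGain g sel k t ω (pathLabel g t ω))) * (1 - l * betGain g sel k (n + 1) ω y)

theorem wealthStep_label {k n : ℕ} (hkn : k ≤ n + 1) (ω : ℕ → 𝒳) :
    wealthStep g sel k n ω (pathLabel g (n + 1) ω) = wealth g sel k (n + 1) ω := by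
  rw [wealth_eq, wealthStep]
  simp_rw [Finset.prod_Icc_succ_top hkn]

theorem labelDetermined_wealthStep (k n : ℕ) (y : Fin (L + 1)) :
    LabelDetermined (pathLabel g) (Finset.Icc k n) fun ω => wealthStep g sel k n ω y := by
  intro ω ω' h
  simp only [wealthStep]
  congr 1
  funext l
  congr 1
  · refine Finset.prod_congr rfl fun t ht => ?_
    have ht' := Finset.mem_Icc.mp ht
    rw [← h t ht, show betGain g sel k t ω _ = betGain g sel k t ω' _ from
      labelDetermined_betGain k t _ ω ω' fun i hi => h i (by simp at hi ⊢; omega)]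
  · rw [show betGain g sel k (n + 1) ω _ = betGain g sel k (n + 1) ω' _ from
      labelDetermined_betGain k (n + 1) _ ω ω' fun i hi => h i (by simp at hi ⊢; omega)]

theorem wealthStep_nonneg (k n : ℕ) (ω : ℕ → 𝒳) (y : Fin (L + 1)) :
    0 ≤ wealthStep g sel k n ω y :=
  intervalIntegral.integral_nonneg (by norm_num) fun l hl =>
    mul_nonneg (Finset.prod_nonneg fun t _ => one_sub_mul_betGain_nonneg hl k t ω _)
      (one_sub_mul_betGain_nonneg hl k _ ω _)

theorem sum_mul_betGain (p : Fin (L + 1) → ℝ) (k t : ℕ) (ω : ℕ → 𝒳) :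
    ∑ y, p y * betGain g sel k t ω y = p (betLabel g sel k t ω) - p 0 := by
  simp [betGain, mul_sub, Finset.sum_sub_distrib]

theorem sum_mul_wealthStep_le {p : Fin (L + 1) → ℝ} (hp : ∑ y, p y = 1) (hp0 : ∀ y, p y ≤ p 0)
    (k n : ℕ) (ω : ℕ → 𝒳) :
    ∑ y, p y * wealthStep g sel k n ω y ≤ wealth g sel k n ω := by
  have hint : ∀ y : Fin (L + 1), Continuous fun l : ℝ => p y * ((∏ t ∈ Finset.Icc k n,
      (1 - l * betGain g sel k t ω (pathLabel g t ω))) *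
        (1 - l * betGain g sel k (n + 1) ω y)) := fun y => by fun_prop
  have hint' : Continuous fun l : ℝ => ∏ t ∈ Finset.Icc k n,
      (1 - l * betGain g sel k t ω (pathLabel g t ω)) := by fun_prop
  simp only [wealthStep, ← intervalIntegral.integral_const_mul]
  rw [← intervalIntegral.integral_finsetSum fun y _ => (hint y).intervalIntegrable _ _, wealth_eq]
  refine intervalIntegral.integral_mono_on (by norm_num)
    ((continuous_finsetSum _ fun y _ => hint y).intervalIntegrable _ _)
    (hint'.intervalIntegrable _ _) fun l hl => ?_
  set Q := ∏ t ∈ Finset.Icc k n, (1 - l * betGain g sel k t ω (pathLabel g t ω)) with hQ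
  have hQ0 : 0 ≤ Q := Finset.prod_nonneg fun t _ => one_sub_mul_betGain_nonneg hl k t ω _
  have : ∑ y, p y * (Q * (1 - l * betGain g sel k (n + 1) ω y)) =
      Q * (∑ y, p y - l * ∑ y, p y * betGain g sel k (n + 1) ω y) := by
    rw [Finset.mul_sum, ← Finset.sum_sub_distrib, Finset.mul_sum]
    exact Finset.sum_congr rfl fun y _ => by ring
  rw [this, hp, sum_mul_betGain]
  have := hp0 (betLabel g sel k (n + 1) ω)
  exact mul_le_of_le_one_right hQ0 (by nlinarith [hl.2])

variable [MeasurableSpace 𝒳]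

theorem measurable_pathLabel (hg : Measurable g) (t : ℕ) : Measurable (pathLabel g t) :=
  hg.comp (measurable_pi_apply t)

theorem measurableSet_lt_stopTime (hg : Measurable g) (α : ℝ) (n : ℕ) :
    MeasurableSet {ω | (n : ℕ∞) < stopTime g sel α ω} :=
  measurableSet_setOfPred.mpr <|
    (labelDetermined_lt_stopTime α n).measurable (measurable_pathLabel hg)

/-- The supermartingale property tested against a past-determined weight `v`, later the indicator of
`n < τ`. -/
theorem lintegral_wealth_succ_le {μ : Measure (ℕ → 𝒳)}
    (hg : Measurable g) (hind : ProbabilityTheory.iIndepFun (pathLabel g) μ)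
    {p : Fin (L + 1) → ℝ} (hμ : ∀ t y, μ (pathLabel g t ⁻¹' {y}) = ENNReal.ofReal (p y))
    (hpos : ∀ y, 0 ≤ p y) (hp : ∑ y, p y = 1) (hp0 : ∀ y, p y ≤ p 0) {k n : ℕ} (hk : 1 ≤ k)
    (hkn : k ≤ n + 1) {v : (ℕ → 𝒳) → ℝ≥0∞}
    (hv : LabelDetermined (pathLabel g) (Finset.Icc 1 n) v) :
    ∫⁻ ω, v ω * ENNReal.ofReal (wealth g sel k (n + 1) ω) ∂μ ≤
      ∫⁻ ω, v ω * ENNReal.ofReal (wealth g sel k n ω) ∂μ := by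
  have hF : ∀ y, LabelDetermined (pathLabel g) (Finset.Icc 1 n)
      fun ω => v ω * ENNReal.ofReal (wealthStep g sel k n ω y) := by
    intro y ω ω' h
    have := labelDetermined_wealthStep (sel := sel) k n y ω ω' fun i hi =>
      h i (by simp at hi ⊢; omega)
    simp only at this ⊢
    rw [this, hv ω ω' h]
  simp_rw [← wealthStep_label hkn]
  rw [lintegral_label_eq_sum (measurable_pathLabel hg) hind (n := n + 1) (by simp) hF]
  refine lintegral_mono fun ω => ?_
  calc ∑ y, μ (pathLabel g (n + 1) ⁻¹' {y}) *
        (v ω * ENNReal.ofReal (wealthStep g sel k n ω y))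
      = v ω * ENNReal.ofReal (∑ y, p y * wealthStep g sel k n ω y) := by
        rw [ENNReal.ofReal_sum_of_nonneg fun y _ =>
          mul_nonneg (hpos y) (wealthStep_nonneg k n ω y), Finset.mul_sum]
        refine Finset.sum_congr rfl fun y _ => ?_
        rw [hμ, ENNReal.ofReal_mul (hpos y)]
        ring
    _ ≤ _ := by
        gcongr
        exact sum_mul_wealthStep_le hp hp0 k n ω

/-- A lower bound for the expected time of a false alarm, for independent labels for which the
label `0` is the most likely one. -/
theorem ofReal_le_lintegral_stopTime {μ : Measure (ℕ → 𝒳)} [IsProbabilityMeasure μ]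
    (hg : Measurable g) (hind : ProbabilityTheory.iIndepFun (pathLabel g) μ)
    {p : Fin (L + 1) → ℝ} (hμ : ∀ t y, μ (pathLabel g t ⁻¹' {y}) = ENNReal.ofReal (p y))
    (hpos : ∀ y, 0 ≤ p y) (hp : ∑ y, p y = 1) (hp0 : ∀ y, p y ≤ p 0) (α : ℝ) :
    ENNReal.ofReal (1 / α) ≤ ∫⁻ ω, (stopTime g sel α ω : ℝ≥0∞) ∂μ := by
  classical
  set c := ENNReal.ofReal (1 / α) with hc
  let A : ℕ → Set (ℕ → 𝒳) := fun n => {ω | (n : ℕ∞) < stopTime g sel α ω}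
  have hA : ∀ n, MeasurableSet (A n) := measurableSet_lt_stopTime hg α
  let v : ℕ → (ℕ → 𝒳) → ℝ≥0∞ := fun n ω => if (n : ℕ∞) < stopTime g sel α ω then 1 else 0
  have hvdet : ∀ n, LabelDetermined (pathLabel g) (Finset.Icc 1 n) (v n) := fun n ω ω' h => by
    have := labelDetermined_lt_stopTime (sel := sel) α n ω ω' h
    simp only [v, this]
  have hvm : ∀ n, Measurable (v n) := fun n => (hvdet n).measurable (measurable_pathLabel hg)
  have hvint : ∀ n, ∫⁻ ω, v n ω ∂μ = μ (A n) := fun n => by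
    rw [← lintegral_indicator_one (hA n)]
    exact lintegral_congr fun ω => by simp [v, A, Set.indicator]
  have hwm : ∀ k n, Measurable fun ω => ENNReal.ofReal (wealth g sel k n ω) := fun k n =>
    ENNReal.measurable_ofReal.comp
      ((labelDetermined_wealth k n).measurable (measurable_pathLabel hg))
  -- Optional stopping by hand: `D n` is the summed wealth while the test runs and is replaced by
  -- `c` once it has stopped. Its mean grows by at most `μ (A n)` per step, the capital of the new
  -- test.
  let D : ℕ → (ℕ → 𝒳) → ℝ≥0∞ := fun n ω =>
    (∑ k ∈ Finset.Icc 1 n, v n ω * ENNReal.ofReal (wealth g sel k n ω)) + c * (1 - v n ω)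
  have hstep : ∀ n, ∫⁻ ω, D (n + 1) ω ∂μ ≤ ∫⁻ ω, D n ω ∂μ + μ (A n) := by
    intro n
    have hpt : ∀ ω, D (n + 1) ω ≤ (∑ k ∈ Finset.Icc 1 (n + 1),
        v n ω * ENNReal.ofReal (wealth g sel k (n + 1) ω)) + c * (1 - v n ω) := by
      intro ω
      by_cases h0 : (n : ℕ∞) < stopTime g sel α ω
      · by_cases h1 : ((n + 1 : ℕ) : ℕ∞) < stopTime g sel α ω
        · simp only [D, v, if_pos h0, if_pos h1, le_refl]
        · simp only [D, v, if_pos h0, if_neg h1]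
          simp only [zero_mul, Finset.sum_const_zero, tsub_zero, mul_one, zero_add, one_mul,
            tsub_self, mul_zero, add_zero]
          -- Here `τ = n + 1`, so the largest wealth, hence the sum, is at least `1/α`.
          have hdet : 1 / α ≤ eDetector g sel (n + 1) ω := by
            rw [lt_stopTime_iff] at h0 h1
            push Not at h1
            obtain ⟨m, hm, hmn, hle⟩ := h1
            rcases Nat.lt_or_ge n m with hnm | hnm
            · obtain rfl : m = n + 1 := by omega
              exact hle
            · exact absurd (h0 m hm hnm) (not_lt.mpr hle)
          rw [eDetector, dif_pos (by omega)] at hdet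
          obtain ⟨k, hk, hkeq⟩ := Finset.exists_mem_eq_sup' (s := Finset.Icc 1 (n + 1))
            (Finset.nonempty_Icc.mpr (by omega)) (fun k => wealth g sel k (n + 1) ω)
          rw [hkeq] at hdet
          exact (ENNReal.ofReal_le_ofReal hdet).trans
            (Finset.single_le_sum (f := fun k => ENNReal.ofReal (wealth g sel k (n + 1) ω))
              (fun _ _ => zero_le) hk)
      · have h1 : ¬ ((n + 1 : ℕ) : ℕ∞) < stopTime g sel α ω := fun h =>
          h0 (lt_of_le_of_lt (by exact_mod_cast Nat.le_succ n) h)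
        simp only [D, v, if_neg h0, if_neg h1]
        simp
    have hm1 : ∀ k n', Measurable fun ω => v n ω * ENNReal.ofReal (wealth g sel k n' ω) :=
      fun k n' => (hvm n).mul (hwm k n')
    calc ∫⁻ ω, D (n + 1) ω ∂μ
        ≤ ∫⁻ ω, ((∑ k ∈ Finset.Icc 1 (n + 1),
            v n ω * ENNReal.ofReal (wealth g sel k (n + 1) ω)) + c * (1 - v n ω)) ∂μ :=
          lintegral_mono hpt
      _ = (∑ k ∈ Finset.Icc 1 (n + 1), ∫⁻ ω, v n ω * ENNReal.ofReal (wealth g sel k (n + 1) ω) ∂μ)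
          + ∫⁻ ω, c * (1 - v n ω) ∂μ := by
          rw [lintegral_add_left (Finset.measurable_sum _ fun k _ => hm1 k _),
            lintegral_finsetSum _ fun k _ => hm1 k _]
      _ ≤ (∑ k ∈ Finset.Icc 1 (n + 1), ∫⁻ ω, v n ω * ENNReal.ofReal (wealth g sel k n ω) ∂μ)
          + ∫⁻ ω, c * (1 - v n ω) ∂μ := by
          refine add_le_add_left (Finset.sum_le_sum fun k hk => ?_) _
          have hk := Finset.mem_Icc.mp hk
          exact lintegral_wealth_succ_le hg hind hμ hpos hp hp0 hk.1 hk.2 (hvdet n)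
      _ = _ := by
          rw [Finset.sum_Icc_succ_top (by omega)]
          simp_rw [wealth_of_lt (Nat.lt_succ_self n), ENNReal.ofReal_one, mul_one]
          rw [hvint, lintegral_add_left (Finset.measurable_sum _ fun k _ => hm1 k _),
            lintegral_finsetSum _ fun k _ => hm1 k _]
          ring
  have hτ : ∫⁻ ω, (stopTime g sel α ω : ℝ≥0∞) ∂μ = ∑' n, μ (A n) := by
    simp_rw [← tsum_lt_eq_coe]
    rw [lintegral_tsum fun n => (hvm n).aemeasurable]
    exact tsum_congr hvint
  have hD : ∀ n, ∫⁻ ω, D n ω ∂μ ≤ ∑ i ∈ Finset.range n, μ (A i) := by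
    intro n
    induction n with
    | zero =>
      have : ∀ ω, ((0 : ℕ) : ℕ∞) < stopTime g sel α ω := fun ω =>
        lt_stopTime_iff.mpr fun m h1 h2 => by omega
      simp only [D, v, if_pos (this _)]
      simp
    | succ n ih =>
      rw [Finset.sum_range_succ]
      exact (hstep n).trans (by gcongr)
  have hAc : ∀ n, c * μ (A n)ᶜ ≤ ∫⁻ ω, (stopTime g sel α ω : ℝ≥0∞) ∂μ := by
    intro n
    rw [hτ]
    refine le_trans ?_ ((hD n).trans (ENNReal.sum_le_tsum _))
    rw [← lintegral_indicator_one (hA n).compl,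
      ← lintegral_const_mul _ (measurable_one.indicator (hA n).compl)]
    refine lintegral_mono fun ω => ?_
    refine le_trans (le_of_eq ?_) le_add_self
    by_cases h0 : (n : ℕ∞) < stopTime g sel α ω <;> simp [v, A, Set.indicator, h0]
  -- If `E τ` is finite then `μ (A n)` tends to `0`, and `c * μ (A n)ᶜ ≤ E τ` passes to the limit.
  by_cases htop : ∑' n, μ (A n) = ⊤
  · rw [hτ, htop]
    exact le_top
  have hlim : Filter.Tendsto (fun n => μ (A n)ᶜ) Filter.atTop (nhds 1) := by
    have h0 := ENNReal.tendsto_atTop_zero_of_tsum_ne_top htop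
    have := ENNReal.Tendsto.sub (tendsto_const_nhds (x := (1 : ℝ≥0∞))) h0 (Or.inl ENNReal.one_ne_top)
    simp only [tsub_zero] at this
    refine this.congr fun n => ?_
    rw [prob_compl_eq_one_sub (hA n)]
  have := ENNReal.Tendsto.const_mul (a := c) hlim (Or.inl one_ne_zero)
  rw [mul_one] at this
  exact le_of_tendsto' this hAc

end Detector
-- Growth of the wealth after the change
-- Comparison with the telescoping sum of `2 (√(n+1) - √n)`; the term `i = 0` is `1 / 0 = 0`.
theorem sum_inv_sqrt_le (n : ℕ) :
    ∑ i ∈ Finset.range (n + 1), 1 / Real.sqrt i ≤ 2 * Real.sqrt n := by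
  induction n with
  | zero => simp
  | succ n ih =>
    rw [Finset.sum_range_succ]
    have hb : 0 < Real.sqrt ((n + 1 : ℕ) : ℝ) := Real.sqrt_pos.mpr (by positivity)
    have hb2 : Real.sqrt ((n + 1 : ℕ) : ℝ) ^ 2 = n + 1 := by
      rw [Real.sq_sqrt (by positivity)]; push_cast; ring
    have ha2 : Real.sqrt (n : ℝ) ^ 2 = n := Real.sq_sqrt (by positivity)
    have : 1 / Real.sqrt ((n + 1 : ℕ) : ℝ) ≤
        2 * (Real.sqrt ((n + 1 : ℕ) : ℝ) - Real.sqrt n) := by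
      rw [div_le_iff₀ hb]
      nlinarith [sq_nonneg (Real.sqrt ((n + 1 : ℕ) : ℝ) - Real.sqrt n)]
    linarith

theorem exp_sub_two_mul_sq_le {x : ℝ} (hx : |x| ≤ 1 / 8) : Real.exp (x - 2 * x ^ 2) ≤ 1 + x := by
  obtain ⟨h1, h2⟩ := abs_le.mp hx
  have hy : |x - 2 * x ^ 2| ≤ 1 := abs_le.mpr ⟨by nlinarith, by nlinarith⟩
  have := (abs_le.mp (Real.abs_exp_sub_one_sub_id_le hy)).2
  have h3 : (1 - 2 * x) ^ 2 ≤ 2 := by nlinarith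
  nlinarith [mul_le_mul_of_nonneg_left h3 (sq_nonneg x)]

section Detector

variable {L : ℕ} {𝒳 : Type u} {g : 𝒳 → Fin (L + 1)}
  {sel : (Fin (L + 1) → ℝ) → Fin (L + 1)}

/-- A leading label has been observed at least as often as any other label. -/
theorem sum_indicator_sub_betLabel_nonpos (hsel : IsArgmaxRule sel) (k i : ℕ) (ω : ℕ → 𝒳)
    (θ : Fin (L + 1)) :
    ∑ j ∈ Finset.range i, ((if pathLabel g (k + j) ω = θ then (1 : ℝ) else 0) -
      (if pathLabel g (k + j) ω = betLabel g sel k (k + i) ω then 1 else 0)) ≤ 0 := by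
  rcases Nat.eq_zero_or_pos i with rfl | hi
  · simp
  have hcount : ∀ m, empirical g k (k + i) ω m =
      (∑ j ∈ Finset.range i, if pathLabel g (k + j) ω = m then (1 : ℝ) else 0) / i := by
    intro m
    rw [empirical, if_neg (by omega), Finset.card_filter, Finset.sum_Ico_eq_sum_range]
    simp [pathLabel, -Finset.sum_boole]
    rfl
  have h := hsel (empirical g k (k + i) ω) θ
  rw [hcount, hcount, div_le_div_iff_of_pos_right (by exact_mod_cast hi)] at h
  rw [Finset.sum_sub_distrib]
  exact sub_nonpos.mpr h

/-- Keep only `l ∈ [-Δ/16, -Δ/32]`. With `x = -l`, the log of the product is at least `x nΔ/4 - 2 n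
x² ≥ n x Δ/8 ≥ nΔ²/256`. -/
theorem wealth_ge {k : ℕ} {T n : ℕ} (hk : k = T + 1) {ω : ℕ → 𝒳} {Δ : ℝ} (hΔ : 0 < Δ)
    (hΔ1 : Δ ≤ 1)
    (hS : n * Δ / 4 ≤ ∑ i ∈ Finset.range n, betGain g sel k (k + i) ω (pathLabel g (k + i) ω)) :
    Δ / 32 * Real.exp (n * Δ ^ 2 / 256) ≤ wealth g sel k (T + n) ω := by
  subst hk
  set V : ℕ → ℝ := fun t => betGain g sel (T + 1) t ω (pathLabel g t ω) with hV
  have hV1 : ∀ t, V t ∈ Set.Icc (-1 : ℝ) 1 := fun t => betGain_mem_Icc _ _ _ _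
  have hcont : Continuous fun l : ℝ => ∏ t ∈ Finset.Icc (T + 1) (T + n), (1 - l * V t) := by
    fun_prop
  have hnn : ∀ l ∈ Set.Icc (-1 : ℝ) 0,
      0 ≤ ∏ t ∈ Finset.Icc (T + 1) (T + n), (1 - l * V t) := fun l hl =>
    Finset.prod_nonneg fun t _ => one_sub_mul_betGain_nonneg hl _ t ω _
  rw [wealth_eq]
  have hsub : ∫ l in (-(Δ / 16))..(-(Δ / 32)),
      ∏ t ∈ Finset.Icc (T + 1) (T + n), (1 - l * V t) ≤
      ∫ l in (-1 : ℝ)..0, ∏ t ∈ Finset.Icc (T + 1) (T + n), (1 - l * V t) := by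
    refine intervalIntegral.integral_mono_interval (by linarith) (by linarith) (by linarith) ?_
      (hcont.intervalIntegrable _ _)
    refine (ae_restrict_iff' measurableSet_Ioc).mpr (ae_of_all _ fun l hl => ?_)
    exact hnn l ⟨hl.1.le, hl.2⟩
  refine le_trans ?_ hsub
  have hconst : Δ / 32 * Real.exp (n * Δ ^ 2 / 256) =
      ∫ _ in (-(Δ / 16))..(-(Δ / 32)), Real.exp (n * Δ ^ 2 / 256) := by
    rw [intervalIntegral.integral_const, smul_eq_mul]
    ring
  rw [hconst]
  refine intervalIntegral.integral_mono_on (by linarith) intervalIntegrable_const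
    (hcont.intervalIntegrable _ _) fun l hl => ?_
  obtain ⟨hl1, hl2⟩ := hl
  have hprod : ∏ t ∈ Finset.Icc (T + 1) (T + n), (1 - l * V t) =
      ∏ i ∈ Finset.range n, (1 - l * V (T + 1 + i)) := by
    have : Finset.Icc (T + 1) (T + n) = Finset.Ico (T + 1) (T + 1 + n) := by
      ext t; simp; omega
    rw [this, Finset.prod_Ico_eq_prod_range, Nat.add_sub_cancel_left]
  rw [hprod]
  have hterm : ∀ i ∈ Finset.range n, Real.exp (-l * V (T + 1 + i) - 2 * l ^ 2) ≤
      1 - l * V (T + 1 + i) := by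
    intro i _
    obtain ⟨h1, h2⟩ := hV1 (T + 1 + i)
    have hx : |-l * V (T + 1 + i)| ≤ 1 / 8 := abs_le.mpr ⟨by nlinarith, by nlinarith⟩
    have hsq : V (T + 1 + i) ^ 2 ≤ 1 := by nlinarith
    calc _ ≤ Real.exp (-l * V (T + 1 + i) - 2 * (-l * V (T + 1 + i)) ^ 2) := by
          refine Real.exp_le_exp.mpr ?_
          nlinarith [mul_le_mul_of_nonneg_left hsq (sq_nonneg l)]
      _ ≤ 1 + -l * V (T + 1 + i) := exp_sub_two_mul_sq_le hx
      _ = _ := by ring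
  refine le_trans ?_ (Finset.prod_le_prod (fun i _ => (Real.exp_pos _).le) hterm)
  rw [← Real.exp_sum, Finset.sum_sub_distrib, ← Finset.mul_sum]
  refine Real.exp_le_exp.mpr ?_
  simp only [Finset.sum_const, Finset.card_range, nsmul_eq_mul]
  have hn : (0 : ℝ) ≤ n := Nat.cast_nonneg n
  have h1 : -l * (n * Δ / 4) ≤ -l * ∑ i ∈ Finset.range n, V (T + 1 + i) :=
    mul_le_mul_of_nonneg_left hS (by linarith)
  have h2 : 0 ≤ n * ((-l - Δ / 32) * Δ) := by
    have : 0 ≤ -l - Δ / 32 := by linarith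
    positivity
  have h3 : 0 ≤ n * ((Δ / 16 + l) * (-l)) := by
    have h4 : 0 ≤ Δ / 16 + l := by linarith
    have h5 : 0 ≤ -l := by linarith
    positivity
  nlinarith

variable [MeasurableSpace 𝒳]

/-- With high probability, betting on the leading label gains linearly in the number of bets. -/
theorem measure_sum_betGain_lt_le {μ : Measure (ℕ → 𝒳)} [IsProbabilityMeasure μ]
    (hg : Measurable g) (hind : ProbabilityTheory.iIndepFun (pathLabel g) μ)
    (hsel : IsArgmaxRule sel) {p : Fin (L + 1) → ℝ} {k : ℕ}
    (hp : ∀ t, k ≤ t → ∀ y, μ.real (pathLabel g t ⁻¹' {y}) = p y) {θ : Fin (L + 1)}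
    (hpos : ∀ y, 0 ≤ p y) (hp1 : p θ ≤ 1) {Δ : ℝ} (hΔ : Δ = p θ - p 0) (hΔ0 : 0 < Δ) {n : ℕ}
    (hn : 4 ≤ n * Δ) :
    μ {ω | ∑ i ∈ Finset.range n, betGain g sel k (k + i) ω (pathLabel g (k + i) ω) < n * Δ / 4} ≤
      ENNReal.ofReal (2 * (L + 1) * (n * Real.exp (-(n * Δ ^ 2 / 128)))) := by
  have hn0 : 0 < n := by
    rcases Nat.eq_zero_or_pos n with rfl | h
    · norm_num at hn
    · exact h
  have hnr : (0 : ℝ) < n := by exact_mod_cast hn0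
  have hY := measurable_pathLabel (g := g) hg
  -- Chosen so that `i * ε i ^ 2` does not depend on `i ≥ 1`: all failure events get the same bound,
  -- while the `ε i` still sum to at most `nΔ/4`.
  set ε : ℕ → ℝ := fun i => Δ / 8 * (Real.sqrt n * (1 / Real.sqrt i)) with hε
  have hε0 : ∀ i, 0 ≤ ε i := fun i => by positivity
  let d : Fin (L + 1) → Fin (L + 1) → ℝ := fun m y =>
    (if y = θ then 1 else 0) - (if y = m then 1 else 0)
  have hd : ∀ m, ∑ y, p y * d m y = p θ - p m := fun m => by
    simp [d, mul_sub, Finset.sum_sub_distrib]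
  -- The leader is random, so every label `m` is compared with `θ`.
  let B : ℕ → Fin (L + 1) → Set (ℕ → 𝒳) := fun i m =>
    {ω | ∑ j ∈ Finset.range i, d m (pathLabel g (k + j) ω) ≤
      (∑ j ∈ Finset.range i, ∑ y, p y * d m y) - i * ε i}
  let B' : Set (ℕ → 𝒳) :=
    {ω | ∑ i ∈ Finset.range n, betGain g sel k (k + i) ω (pathLabel g (k + i) ω) ≤
      (∑ i ∈ Finset.range n, ∑ y, p y * betGain g sel k (k + i) ω y) - n * (Δ / 4)}
  have hB : ∀ i ∈ Finset.Ico 1 n, ∀ m, μ (B i m) ≤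
      ENNReal.ofReal (Real.exp (-(n * Δ ^ 2 / 128))) := by
    intro i hi m
    have hi0 : 0 < i := by simp at hi; omega
    have hir : (0 : ℝ) < i := by exact_mod_cast hi0
    refine (measure_sum_le_sub_le hY hind hp (f := fun _ _ y => d m y) ?_ ?_ i (hε0 i)).trans ?_
    · intro _ _ y
      simp only [d]
      constructor <;> split_ifs <;> norm_num
    · exact fun _ _ _ _ _ => rfl
    · refine ENNReal.ofReal_le_ofReal (Real.exp_le_exp.mpr (le_of_eq ?_))
      simp only [hε, mul_pow, div_pow, one_pow, Real.sq_sqrt hir.le, Real.sq_sqrt hnr.le]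
      field_simp
      ring
  have hB' : μ B' ≤ ENNReal.ofReal (Real.exp (-(n * Δ ^ 2 / 128))) := by
    refine (measure_sum_le_sub_le hY hind hp (f := fun t ω y => betGain g sel k t ω y)
      (fun t ω y => betGain_mem_Icc k t ω y) (fun t y => labelDetermined_betGain k t y) n
      (by positivity)).trans ?_
    refine ENNReal.ofReal_le_ofReal (Real.exp_le_exp.mpr ?_)
    have : 0 ≤ n * Δ ^ 2 := by positivity
    nlinarith
  have hsub : {ω | ∑ i ∈ Finset.range n, betGain g sel k (k + i) ω (pathLabel g (k + i) ω) <
      n * Δ / 4} ⊆ B' ∪ ⋃ i ∈ Finset.Ico 1 n, ⋃ m ∈ Finset.univ, B i m := by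
    intro ω hω
    by_contra hc
    simp only [Set.mem_union, Set.mem_iUnion, not_or, not_exists] at hc
    obtain ⟨hc1, hc2⟩ := hc
    simp only [B', B, Set.mem_ofPred_eq, not_le, sum_mul_betGain, hd, Finset.sum_const,
      Finset.card_range, nsmul_eq_mul] at hω hc1 hc2
    -- Outside `B i m` a leader `m` trails `θ` in probability by less than `ε i`; the first bet,
    -- made without data, may lose `1`. In total `nΔ - 1 - nΔ/4 - nΔ/4 ≥ nΔ/4`, as `nΔ ≥ 4`.
    have hlag : ∀ i ∈ Finset.range n, p θ - p (betLabel g sel k (k + i) ω) ≤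
        (if i = 0 then 1 else 0) + ε i := by
      intro i hi
      rcases Nat.eq_zero_or_pos i with rfl | hi0
      · have := hpos (betLabel g sel k (k + 0) ω)
        have := hε0 0
        simp only [if_true]
        linarith
      · have h1 := hc2 i (Finset.mem_Ico.mpr ⟨hi0, Finset.mem_range.mp hi⟩)
          (betLabel g sel k (k + i) ω) (Finset.mem_univ _)
        have h2 := sum_indicator_sub_betLabel_nonpos (g := g) hsel k i ω θ
        have h3 := h1.trans_le h2
        have hir : (0 : ℝ) < i := by exact_mod_cast hi0
        rw [if_neg (by omega), zero_add]
        nlinarith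
    have hsum := Finset.sum_le_sum hlag
    have hε2 : ∑ i ∈ Finset.range n, ε i ≤ n * Δ / 4 := by
      have h1 : ∑ i ∈ Finset.range n, 1 / Real.sqrt i ≤ 2 * Real.sqrt n := by
        refine le_trans ?_ (sum_inv_sqrt_le n)
        exact Finset.sum_le_sum_of_subset_of_nonneg (Finset.range_mono (Nat.le_succ n))
          fun _ _ _ => by positivity
      simp only [hε, ← Finset.mul_sum]
      calc _ ≤ Δ / 8 * (Real.sqrt n * (2 * Real.sqrt n)) := by gcongr
        _ = Δ / 4 * (Real.sqrt n * Real.sqrt n) := by ring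
        _ = _ := by rw [Real.mul_self_sqrt hnr.le]; ring
    rw [Finset.sum_add_distrib, Finset.sum_ite_eq' (Finset.range n) 0,
      if_pos (Finset.mem_range.mpr hn0)] at hsum
    simp only [Finset.sum_sub_distrib, Finset.sum_const, Finset.card_range, nsmul_eq_mul]
      at hsum hc1
    have : n * p θ - n * p 0 = n * Δ := by rw [hΔ]; ring
    linarith
  set e := Real.exp (-(n * Δ ^ 2 / 128)) with he
  have he0 : 0 < e := Real.exp_pos _
  calc _ ≤ μ (B' ∪ ⋃ i ∈ Finset.Ico 1 n, ⋃ m ∈ Finset.univ, B i m) := measure_mono hsub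
    _ ≤ μ B' + ∑ i ∈ Finset.Ico 1 n, ∑ m, μ (B i m) := by
      refine (measure_union_le _ _).trans ?_
      gcongr
      refine (measure_biUnion_finset_le _ _).trans ?_
      exact Finset.sum_le_sum fun i _ => measure_biUnion_finset_le _ _
    _ ≤ ENNReal.ofReal e + ∑ i ∈ Finset.Ico 1 n, ∑ m : Fin (L + 1), ENNReal.ofReal e := by
      refine add_le_add hB' (Finset.sum_le_sum fun i hi => Finset.sum_le_sum fun m _ => hB i hi m)
    _ = ENNReal.ofReal (e + (n - 1 : ℕ) * ((L + 1 : ℕ) * e)) := by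
      rw [ENNReal.ofReal_add he0.le (by positivity), ENNReal.ofReal_mul (by positivity),
        ENNReal.ofReal_mul (by positivity)]
      simp only [Finset.sum_const, Nat.card_Ico, Finset.card_univ, Fintype.card_fin, nsmul_eq_mul,
        ENNReal.ofReal_natCast]
    _ ≤ _ := by
      refine ENNReal.ofReal_le_ofReal ?_
      rw [Nat.cast_sub hn0]
      have h1 : (1 : ℝ) ≤ n := by exact_mod_cast hn0
      have h2 : (0 : ℝ) ≤ L := Nat.cast_nonneg L
      push_cast
      have h3 : 0 ≤ (n - 1) * ((L + 1) * e) := mul_nonneg (by linarith) (by positivity)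
      have h4 : 0 ≤ L * e := by positivity
      nlinarith

end Detector

/-! ### Tail series and the conditional delay -/

theorem mul_exp_neg_mul_le {a : ℝ} (ha : 0 < a) (n : ℝ) :
    n * Real.exp (-(n * a)) ≤ 2 / a * Real.exp (-(n * a / 2)) := by
  have h := Real.add_one_le_exp (n * a / 2)
  have h1 : n ≤ 2 / a * Real.exp (n * a / 2) := by
    rw [div_mul_eq_mul_div, le_div_iff₀ ha]
    linarith
  calc n * Real.exp (-(n * a)) ≤ 2 / a * Real.exp (n * a / 2) * Real.exp (-(n * a)) := by gcongr
    _ = _ := by rw [mul_assoc, ← Real.exp_add]; ring_nf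

theorem one_div_one_sub_exp_neg_le {x : ℝ} (hx : 0 < x) (hx1 : x ≤ 1) :
    1 / (1 - Real.exp (-x)) ≤ 2 / x := by
  have h := Real.add_one_le_exp x
  have h1 : Real.exp (-x) ≤ 1 / (1 + x) := by
    rw [Real.exp_neg, inv_eq_one_div]
    exact one_div_le_one_div_of_le (by linarith) (by linarith)
  have h2 : 1 / (1 + x) ≤ 1 - x / 2 := by
    rw [div_le_iff₀ (by linarith)]
    nlinarith
  rw [show 2 / x = 1 / (x / 2) by field_simp]
  exact one_div_le_one_div_of_le (by linarith) (by linarith)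

/-- Half of the exponent absorbs the factor `i + m`; the other half leaves a geometric series of
ratio `exp(-a/2)`. -/
theorem tsum_mul_exp_le {a : ℝ} (ha : 0 < a) (ha2 : a ≤ 2) (m : ℕ) {c : ℝ} (hc : 0 ≤ c) :
    ∑' i : ℕ, ENNReal.ofReal (c * ((i + m : ℕ) * Real.exp (-((i + m : ℕ) * a)))) ≤
      ENNReal.ofReal (c * (8 / a ^ 2) * Real.exp (-(m * a / 2))) := by
  set r := Real.exp (-(a / 2)) with hr
  have hr0 : 0 < r := Real.exp_pos _
  have hr1 : r < 1 := Real.exp_lt_one_iff.mpr (by linarith)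
  set K := c * (2 / a) * Real.exp (-(m * a / 2)) with hK
  have hK0 : 0 ≤ K := by positivity
  have hterm : ∀ i : ℕ, c * ((i + m : ℕ) * Real.exp (-((i + m : ℕ) * a))) ≤ K * r ^ i := by
    intro i
    calc _ ≤ c * (2 / a * Real.exp (-((i + m : ℕ) * a / 2))) :=
          mul_le_mul_of_nonneg_left (mul_exp_neg_mul_le ha _) hc
      _ = K * r ^ i := by
          rw [hK, hr, ← Real.exp_nat_mul, mul_assoc _ (Real.exp _), ← Real.exp_add]
          push_cast
          ring_nf
  calc _ ≤ ∑' i : ℕ, ENNReal.ofReal (K * r ^ i) :=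
        ENNReal.tsum_le_tsum fun i => ENNReal.ofReal_le_ofReal (hterm i)
    _ = ENNReal.ofReal (K * (1 - r)⁻¹) := by
        rw [← ENNReal.ofReal_tsum_of_nonneg (fun i => by positivity)
          ((summable_geometric_of_lt_one hr0.le hr1).mul_left K), tsum_mul_left,
          tsum_geometric_of_lt_one hr0.le hr1]
    _ ≤ _ := by
        refine ENNReal.ofReal_le_ofReal ?_
        have := one_div_one_sub_exp_neg_le (x := a / 2) (by linarith) (by linarith)
        rw [one_div] at this
        calc _ ≤ K * (2 / (a / 2)) := by gcongr
          _ = _ := by rw [hK]; field_simp; ring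

section Delay

variable {L : ℕ} {𝒳 : Type u} {g : 𝒳 → Fin (L + 1)}
  {sel : (Fin (L + 1) → ℝ) → Fin (L + 1)}

theorem wealth_lt_of_lt_stopTime_sub {α : ℝ} {T n : ℕ} (hn : 1 ≤ n) {ω : ℕ → 𝒳}
    (h : (n : ℕ∞) < stopTime g sel α ω - T) : wealth g sel (T + 1) (T + n) ω < 1 / α := by
  have h' : ((T + n : ℕ) : ℕ∞) < stopTime g sel α ω := by
    have := lt_tsub_iff_left.mp h
    exact_mod_cast this
  exact (wealth_le_eDetector (by omega) (by omega) ω).trans_lt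
    (lt_stopTime_iff.mp h' (T + n) (by omega) le_rfl)

theorem stopTime_sub_le (α : ℝ) (T : ℕ) {m : ℕ} (hm : 1 ≤ m) (ω : ℕ → 𝒳) :
    ((stopTime g sel α ω - T : ℕ∞) : ℝ≥0∞) ≤ m + ∑' i : ℕ,
      {ω | wealth g sel (T + 1) (T + (i + m)) ω < 1 / α}.indicator 1 ω := by
  rw [← tsum_lt_eq_coe, ← ENNReal.summable.sum_add_tsum_nat_add' (k := m)]
  refine add_le_add ?_ (ENNReal.tsum_le_tsum fun i => ?_)
  · calc _ ≤ ∑ i ∈ Finset.range m, (1 : ℝ≥0∞) := by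
          refine Finset.sum_le_sum fun i _ => ?_
          split_ifs <;> simp
      _ = m := by simp
  · split_ifs with h
    · rw [Set.indicator_of_mem]
      · simp
      · exact wealth_lt_of_lt_stopTime_sub (by omega) h
    · exact zero_le

variable [MeasurableSpace 𝒳]

/-- The test started at `T + 1`, not `T`, is independent of the conditioning σ-algebra, which
contains the label at time `T`. So the bound of `stopTime_sub_le` has constant conditional
expectation. -/
theorem condLExp_stopTime_sub_le {μ : Measure (ℕ → 𝒳)} [IsProbabilityMeasure μ]
    (hg : Measurable g) (hind : ProbabilityTheory.iIndepFun (pathLabel g) μ)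
    (α : ℝ) (T : ℕ) {m : ℕ} (hm : 1 ≤ m) :
    condLExp (outputSigma g T) μ
      (fun ω => ((stopTime g sel α ω - (T : ℕ∞) : ℕ∞) : ℝ≥0∞)) ≤ᵐ[μ]
      fun _ => m + ∑' i : ℕ, μ {ω | wealth g sel (T + 1) (T + (i + m)) ω < 1 / α} := by
  have hY := measurable_pathLabel (g := g) hg
  let B : ℕ → Set (ℕ → 𝒳) := fun i => {ω | wealth g sel (T + 1) (T + (i + m)) ω < 1 / α}
  have hσ : outputSigma g T = labelSigma (pathLabel g) (Finset.Icc 1 T : Finset ℕ) := rfl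
  have hle : outputSigma g T ≤ MeasurableSpace.pi := hσ ▸ labelSigma_le hY _
  have hBσ : ∀ i, MeasurableSet[labelSigma (pathLabel g)
      (Finset.Icc (T + 1) (T + (i + m)) : Finset ℕ)] (B i) := fun i =>
    (labelDetermined_wealth (T + 1) (T + (i + m))).measurable_labelSigma measurableSet_Iio
  have hB : ∀ i, MeasurableSet (B i) := fun i => labelSigma_le hY _ _ (hBσ i)
  have hmono := condLExp_mono (mΩ := outputSigma g T) (P := μ)
    (ae_of_all _ fun ω => stopTime_sub_le (g := g) (sel := sel) α T hm ω)
  refine hmono.trans (Filter.EventuallyEq.le ?_)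
  refine (ae_eq_condLExp hle μ _ measurable_const fun s hs => ?_).symm
  have hs' : MeasurableSet s := hle s hs
  have hindB : ∀ i, μ (B i ∩ s) = μ (B i) * μ s := by
    intro i
    have hdis : Disjoint ((Finset.Icc (T + 1) (T + (i + m)) : Finset ℕ) : Set ℕ)
        (Finset.Icc 1 T : Finset ℕ) := by
      rw [Finset.disjoint_coe, Finset.disjoint_left]
      intro t h1 h2
      simp at h1 h2
      omega
    exact (ProbabilityTheory.Indep_iff _ _ μ).mp (indep_labelSigma hY hind hdis) _ _ (hBσ i)
      (hσ ▸ hs)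
  rw [setLIntegral_const, lintegral_add_left measurable_const, setLIntegral_const,
    lintegral_tsum fun i => (measurable_one.indicator (hB i)).aemeasurable, add_mul,
    ← ENNReal.tsum_mul_right]
  congr 1
  refine tsum_congr fun i => ?_
  rw [lintegral_indicator_one (hB i), Measure.restrict_apply (hB i), hindB]

/-- The expected conditional delay, with explicit constants. -/
theorem essSup_condLExp_stopTime_sub_le {μ : Measure (ℕ → 𝒳)} [IsProbabilityMeasure μ]
    (hg : Measurable g) (hind : ProbabilityTheory.iIndepFun (pathLabel g) μ)
    (hsel : IsArgmaxRule sel) {p : Fin (L + 1) → ℝ} {T : ℕ}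
    (hp : ∀ t, T + 1 ≤ t → ∀ y, μ.real (pathLabel g t ⁻¹' {y}) = p y) {θ : Fin (L + 1)}
    (hpos : ∀ y, 0 ≤ p y) (hp1 : p θ ≤ 1) {Δ : ℝ} (hΔ : Δ = p θ - p 0) (hΔ0 : 0 < Δ)
    {α : ℝ} (hα : 0 < α) (hα1 : α < 1) :
    essSup (condLExp (outputSigma g T) μ
      (fun ω => ((stopTime g sel α ω - (T : ℕ∞) : ℕ∞) : ℝ≥0∞))) μ ≤
      ENNReal.ofReal
        ((256 * Real.log (128 * (L + 1) / (α * Δ ^ 2)) + 2049) / Δ ^ 2) := by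
  have hΔ1 : Δ ≤ 1 := by have := hpos 0; linarith
  have hL : (0 : ℝ) ≤ L := Nat.cast_nonneg L
  -- Once `nΔ² ≥ 256 log x`, the wealth bound is at least `Δ/32 * x ≥ 1/α`; the factor `(L+1)/Δ²` in
  -- `x` also cancels the union bound and one `1/Δ²` in the tail sum.
  set x : ℝ := 128 * (L + 1) / (α * Δ ^ 2) with hx
  have hΔ2 : Δ ^ 2 ≤ 1 := pow_le_one₀ hΔ0.le hΔ1
  have hden : 0 < α * Δ ^ 2 := by positivity
  have hden1 : α * Δ ^ 2 ≤ 1 := mul_le_one₀ hα1.le (by positivity) hΔ2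
  have hx128 : 128 ≤ x := by
    rw [hx, le_div_iff₀ hden]
    nlinarith
  have hx0 : 0 < x := by linarith
  set Λ := Real.log x with hΛ
  have hΛ1 : 1 / 2 ≤ Λ := by
    have h1 := Real.one_sub_inv_le_log_of_pos hx0
    have h2 : x⁻¹ ≤ 1 / 2 := by
      rw [inv_eq_one_div]
      exact one_div_le_one_div_of_le (by norm_num) (by linarith)
    linarith
  set m := ⌈256 * Λ / Δ ^ 2⌉₊ with hm
  have hmge : 256 * Λ / Δ ^ 2 ≤ m := Nat.le_ceil _
  have hmle : (m : ℝ) ≤ 256 * Λ / Δ ^ 2 + 1 := (Nat.ceil_lt_add_one (by positivity)).le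
  have hm1 : 1 ≤ m := Nat.ceil_pos.mpr (by positivity)
  have hbig : ∀ i : ℕ, 256 * Λ ≤ (i + m : ℕ) * Δ ^ 2 := by
    intro i
    rw [div_le_iff₀ (by positivity)] at hmge
    refine hmge.trans ?_
    gcongr
    omega
  have hB : ∀ i : ℕ, μ {ω | wealth g sel (T + 1) (T + (i + m)) ω < 1 / α} ≤
      ENNReal.ofReal (2 * (L + 1) * ((i + m : ℕ) *
        Real.exp (-((i + m : ℕ) * (Δ ^ 2 / 128))))) := by
    intro i
    have h4 : 4 ≤ (i + m : ℕ) * Δ := by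
      have h1 : ((i + m : ℕ) : ℝ) * Δ ^ 2 ≤ (i + m : ℕ) * Δ := by
        gcongr
        nlinarith
      linarith [hbig i]
    rw [← mul_div_assoc]
    refine le_trans (measure_mono ?_)
      (measure_sum_betGain_lt_le (k := T + 1) hg hind hsel hp hpos hp1 hΔ hΔ0 h4)
    intro ω hω
    simp only [Set.mem_ofPred_eq] at hω ⊢
    by_contra! hc
    refine absurd (wealth_ge rfl hΔ0 hΔ1 hc) (not_le.mpr (hω.trans_le ?_))
    have hexp : x ≤ Real.exp ((i + m : ℕ) * Δ ^ 2 / 256) := by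
      rw [← Real.log_le_iff_le_exp hx0]
      linarith [hbig i]
    refine le_trans ?_ (mul_le_mul_of_nonneg_left hexp (by positivity))
    rw [hx, show Δ / 32 * (128 * (L + 1) / (α * Δ ^ 2)) = (4 * (L + 1) / Δ) / α by
      field_simp; ring]
    gcongr
    rw [le_div_iff₀ hΔ0]
    linarith
  have htail : ∑' i : ℕ, μ {ω | wealth g sel (T + 1) (T + (i + m)) ω < 1 / α} ≤
      ENNReal.ofReal (2048 / Δ ^ 2) := by
    refine (ENNReal.tsum_le_tsum hB).trans
      ((tsum_mul_exp_le (by positivity) (by linarith) m (by positivity)).trans ?_)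
    refine ENNReal.ofReal_le_ofReal ?_
    have hexp : Real.exp (-(m * (Δ ^ 2 / 128) / 2)) ≤ Δ ^ 2 / (128 * (L + 1)) := by
      calc _ ≤ Real.exp (-Λ) := by
            refine Real.exp_le_exp.mpr ?_
            have := hbig 0
            rw [zero_add] at this
            linarith
        _ = α * Δ ^ 2 / (128 * (L + 1)) := by
            rw [Real.exp_neg, hΛ, Real.exp_log hx0, hx, inv_div]
        _ ≤ _ := by
            gcongr
            nlinarith [sq_nonneg Δ]
    calc _ ≤ 2 * ((L : ℝ) + 1) * (8 / (Δ ^ 2 / 128) ^ 2) * (Δ ^ 2 / (128 * (L + 1))) := by gcongr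
      _ = _ := by field_simp; norm_num
  refine essSup_le_of_ae_le _ ((condLExp_stopTime_sub_le hg hind α T hm1).trans
    (ae_of_all _ fun _ => ?_))
  refine (add_le_add_right htail _).trans ?_
  rw [← ENNReal.ofReal_natCast, ← ENNReal.ofReal_add (by positivity) (by positivity)]
  refine ENNReal.ofReal_le_ofReal ?_
  have h1 : 1 ≤ 1 / Δ ^ 2 := by rw [le_div_iff₀ (by positivity)]; linarith
  calc _ ≤ 256 * Λ / Δ ^ 2 + 1 / Δ ^ 2 + 2048 / Δ ^ 2 := by linarith
    _ = _ := by ring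

end Delay

/-! ### Specialization to product laws -/

section ProductLaw

variable {L : ℕ} {𝒳 : Type u} [MeasurableSpace 𝒳] {g : 𝒳 → Fin (L + 1)}

theorem iIndepFun_pathLabel (hg : Measurable g) (ν : ℕ → Measure 𝒳)
    [∀ t, IsProbabilityMeasure (ν t)] :
    ProbabilityTheory.iIndepFun (pathLabel g) (Measure.infinitePi ν) :=
  ProbabilityTheory.iIndepFun_infinitePi fun _ => hg

theorem infinitePi_pathLabel_preimage (hg : Measurable g) (ν : ℕ → Measure 𝒳)
    [∀ t, IsProbabilityMeasure (ν t)] (t : ℕ) (y : Fin (L + 1)) :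
    Measure.infinitePi ν (pathLabel g t ⁻¹' {y}) = ν t {x | g x = y} := by
  have h : MeasurableSet {x | g x = y} := hg (measurableSet_singleton y)
  rw [← Measure.infinitePi_map_eval ν t, Measure.map_apply (measurable_pi_apply t) h]
  rfl

theorem sum_labelProb (P : Fin (L + 1) → Measure 𝒳) [∀ i, IsProbabilityMeasure (P i)]
    (hg : Measurable g) (θ : Fin (L + 1)) : ∑ y, labelProb P g θ y = 1 := by
  have h := sum_measureReal_preimage_singleton (μ := P θ) (f := g) Finset.univ
    fun y _ => hg (measurableSet_singleton y)
  simpa [labelProb, Set.preimage] using h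

theorem gap_pos {P : Fin (L + 1) → Measure 𝒳} (h : IsSeparable P g) {θ : Fin (L + 1)}
    (hθ : θ ≠ 0) : 0 < gap P g θ :=
  sub_pos.mpr (h θ 0 hθ.symm)

theorem gap_le_one (P : Fin (L + 1) → Measure 𝒳) [∀ i, IsProbabilityMeasure (P i)]
    (θ : Fin (L + 1)) : gap P g θ ≤ 1 :=
  (sub_le_self _ measureReal_nonneg).trans measureReal_le_one

theorem worstDelay_le (P : Fin (L + 1) → Measure 𝒳) [∀ i, IsProbabilityMeasure (P i)]
    (hg : Measurable g) (hsep : IsSeparable P g) {sel : (Fin (L + 1) → ℝ) → Fin (L + 1)}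
    (hsel : IsArgmaxRule sel) {α : ℝ} (hα : 0 < α) (hα1 : α < 1) {θ : Fin (L + 1)}
    (hθ : θ ≠ 0) :
    worstDelay P g sel α θ ≤ ENNReal.ofReal
      ((256 * Real.log (128 * (L + 1) / (α * gap P g θ ^ 2)) + 2049) / gap P g θ ^ 2) := by
  refine iSup_le fun T => ?_
  have hν : ∀ t, IsProbabilityMeasure (if t < T then P 0 else P θ) := fun t => by
    split_ifs <;> infer_instance
  unfold changeLaw
  refine essSup_condLExp_stopTime_sub_le (p := labelProb P g θ) (θ := θ) hg
    (iIndepFun_pathLabel hg _) hsel (fun t ht y => ?_) (fun _ => measureReal_nonneg)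
    measureReal_le_one rfl (gap_pos hsep hθ) hα hα1
  rw [measureReal_def, infinitePi_pathLabel_preimage hg, if_neg (by omega)]
  rfl

end ProductLaw

/-! ### Simplification of the delay bound -/

/-- If `Δ⁴ (L+1) ≤ 1`, then `log(L+1) ≤ 4 log(1/Δ) ≤ 4ℓ`. Otherwise `1/Δ² ≤ √(L+1)`, and `1 +
log(L+1) ≤ 2√(L+1)` bounds the product by `2(L+1)`. -/
theorem one_add_log_div_sq_le {L : ℕ} (hL : 1 ≤ L) {Δ ℓ : ℝ} (hΔ : 0 < Δ) (hℓ : 0 ≤ ℓ)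
    (hΔℓ : Real.log (1 / Δ) ≤ ℓ) :
    (1 + Real.log (L + 1)) / Δ ^ 2 ≤ 12 * (ℓ / Δ ^ 2 + L) := by
  have hL1 : (1 : ℝ) ≤ L := by exact_mod_cast hL
  set N : ℝ := L + 1 with hN
  have hN0 : 0 < N := by linarith
  rcases le_total 1 (Δ ^ 4 * N) with h | h
  · have hs : 0 < Real.sqrt N := Real.sqrt_pos.mpr hN0
    have hss : Real.sqrt N * Real.sqrt N = N := Real.mul_self_sqrt hN0.le
    have h1 : 1 / Δ ^ 2 ≤ Real.sqrt N := by
      rw [Real.le_sqrt' (by positivity), div_pow, one_pow, ← pow_mul, div_le_iff₀ (by positivity),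
        mul_comm]
      exact h
    have h2 : Real.log N ≤ 2 * (Real.sqrt N - 1) := by
      have h3 := Real.log_le_sub_one_of_pos hs
      rw [Real.log_sqrt hN0.le] at h3
      linarith
    calc (1 + Real.log N) / Δ ^ 2 = (1 + Real.log N) * (1 / Δ ^ 2) := by ring
      _ ≤ (2 * Real.sqrt N) * Real.sqrt N := by
          gcongr
          linarith
      _ = 2 * N := by rw [mul_assoc, hss]
      _ ≤ 12 * L := by linarith
      _ ≤ _ := by
          have : 0 ≤ ℓ / Δ ^ 2 := by positivity
          linarith
  · have h1 : Real.log N ≤ 4 * ℓ := by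
      have h2 := Real.log_nonpos (by positivity) h
      rw [Real.log_mul (by positivity) hN0.ne', Real.log_pow] at h2
      rw [one_div, Real.log_inv] at hΔℓ
      push_cast at h2
      linarith
    have h2 : 1 ≤ 2 * Real.log N := by
      have h3 : Real.log 2 ≤ Real.log N := Real.log_le_log (by norm_num) (by linarith)
      have := Real.log_two_gt_d9
      linarith
    calc (1 + Real.log N) / Δ ^ 2 ≤ 12 * ℓ / Δ ^ 2 := by
          gcongr
          linarith
      _ ≤ _ := by
          rw [mul_div_assoc]
          linarith

theorem delay_constant_le {L : ℕ} (hL : 1 ≤ L) {Δ α : ℝ} (hΔ : 0 < Δ) (hΔ1 : Δ ≤ 1) (hα : 0 < α)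
    (hα1 : α < 1) :
    (256 * Real.log (128 * (L + 1) / (α * Δ ^ 2)) + 2049) / Δ ^ 2 ≤
      50000 * (Real.log (1 / (α * Δ)) / Δ ^ 2 + L) := by
  set ℓ := Real.log (1 / (α * Δ)) with hℓ
  have hℓ' : ℓ = -Real.log α - Real.log Δ := by
    rw [hℓ, one_div, Real.log_inv, Real.log_mul hα.ne' hΔ.ne']
    ring
  have hlα := Real.log_nonpos hα.le hα1.le
  have hlΔ := Real.log_nonpos hΔ.le hΔ1
  have hℓ0 : 0 ≤ ℓ := by linarith
  have hmain := one_add_log_div_sq_le hL hΔ hℓ0 (by rw [one_div, Real.log_inv]; linarith)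
  have h2 : (0 : ℝ) ≤ L := Nat.cast_nonneg L
  have hN : (0 : ℝ) < L + 1 := by positivity
  -- The `2ℓ` comes from `α Δ² ≥ (α Δ)²`.
  have hx : Real.log (128 * (L + 1) / (α * Δ ^ 2)) ≤ 7 + Real.log (L + 1) + 2 * ℓ := by
    rw [Real.log_div (by positivity) (by positivity), Real.log_mul (by norm_num) hN.ne',
      Real.log_mul hα.ne' (by positivity), Real.log_pow, show (128 : ℝ) = 2 ^ 7 by norm_num,
      Real.log_pow]
    have := Real.log_two_lt_d9
    push_cast
    linarith
  have hlogN : 0 ≤ Real.log ((L : ℝ) + 1) := Real.log_nonneg (by linarith)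
  calc _ ≤ (4096 * (1 + Real.log (L + 1)) + 512 * ℓ) / Δ ^ 2 :=
        div_le_div_of_nonneg_right (by linarith) (by positivity)
    _ = 4096 * ((1 + Real.log (L + 1)) / Δ ^ 2) + 512 * (ℓ / Δ ^ 2) := by ring
    _ ≤ _ := by
        have h1 : 0 ≤ ℓ / Δ ^ 2 := by positivity
        linarith

theorem worstDelay_le_log_add {L : ℕ} {𝒳 : Type u} [MeasurableSpace 𝒳] {g : 𝒳 → Fin (L + 1)}
    (hL : 1 ≤ L) (P : Fin (L + 1) → Measure 𝒳) [∀ i, IsProbabilityMeasure (P i)]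
    (hg : Measurable g) (hsep : IsSeparable P g) {sel : (Fin (L + 1) → ℝ) → Fin (L + 1)}
    (hsel : IsArgmaxRule sel) {α : ℝ} (hα : 0 < α) (hα1 : α < 1) {θ : Fin (L + 1)}
    (hθ : θ ≠ 0) :
    worstDelay P g sel α θ ≤ ENNReal.ofReal
      (50000 * (Real.log (1 / (α * gap P g θ)) / gap P g θ ^ 2 + L)) :=
  (worstDelay_le P hg hsep hsel hα hα1 hθ).trans <| ENNReal.ofReal_le_ofReal <|
    delay_constant_le hL (gap_pos hsep hθ) (gap_le_one P θ) hα hα1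

end ChangeDetection

theorem theorem2 :
    -- the expected time of a false alarm is at least `1 / α`
    (∀ (L : ℕ) (𝒳 : Type u) [MeasurableSpace 𝒳] (P : Fin (L + 1) → Measure 𝒳)
        [∀ i, IsProbabilityMeasure (P i)] (g : 𝒳 → Fin (L + 1))
        (sel : (Fin (L + 1) → ℝ) → Fin (L + 1)) (α : ℝ),
        1 ≤ L → Measurable g → ChangeDetection.IsSeparable P g →
        ChangeDetection.IsArgmaxRule sel → 0 < α → α < 1 →
        ENNReal.ofReal (1 / α) ≤ ChangeDetection.runLength P g sel α) ∧
    -- the order of the delay, with a constant that is uniform over all problem instances with `L`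
    -- alternatives, as long as `α * Δ` stays away from `1`
    (∀ (L : ℕ) (c : ℝ), 1 ≤ L → 0 < c → c < 1 → ∃ C : ℝ, 0 < C ∧
      ∀ (𝒳 : Type u) [MeasurableSpace 𝒳] (P : Fin (L + 1) → Measure 𝒳)
        [∀ i, IsProbabilityMeasure (P i)] (g : 𝒳 → Fin (L + 1))
        (sel : (Fin (L + 1) → ℝ) → Fin (L + 1)) (α : ℝ) (θ : Fin (L + 1)),
        Measurable g → ChangeDetection.IsSeparable P g →
        ChangeDetection.IsArgmaxRule sel → 0 < α → α < 1 → θ ≠ 0 →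
        α * ChangeDetection.gap P g θ ≤ c →
        ChangeDetection.worstDelay P g sel α θ ≤
          ENNReal.ofReal (C * (Real.log (1 / (α * ChangeDetection.gap P g θ)) /
            ChangeDetection.gap P g θ ^ 2))) ∧
    -- the same for every `α < 1`, with a universal constant and a lower-order term
    (∃ C : ℝ, 0 < C ∧
      ∀ (L : ℕ) (𝒳 : Type u) [MeasurableSpace 𝒳] (P : Fin (L + 1) → Measure 𝒳)
        [∀ i, IsProbabilityMeasure (P i)] (g : 𝒳 → Fin (L + 1))
        (sel : (Fin (L + 1) → ℝ) → Fin (L + 1)) (α : ℝ) (θ : Fin (L + 1)),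
        1 ≤ L → Measurable g → ChangeDetection.IsSeparable P g →
        ChangeDetection.IsArgmaxRule sel → 0 < α → α < 1 → θ ≠ 0 →
        ChangeDetection.worstDelay P g sel α θ ≤
          ENNReal.ofReal (C * (Real.log (1 / (α * ChangeDetection.gap P g θ)) /
            ChangeDetection.gap P g θ ^ 2 + L))) := by
  refine ⟨?_, ?_, 50000, by norm_num, ?_⟩
  · intro L 𝒳 _ P _ g sel α _ hg hsep _ _ _
    refine ChangeDetection.ofReal_le_lintegral_stopTime (p := ChangeDetection.labelProb P g 0) hg
      (ChangeDetection.iIndepFun_pathLabel hg _) (fun t y => ?_) (fun _ => measureReal_nonneg)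
      (ChangeDetection.sum_labelProb P hg 0) (fun y => ?_) α
    · rw [ChangeDetection.infinitePi_pathLabel_preimage hg, ChangeDetection.labelProb,
        ofReal_measureReal]
    · rcases eq_or_ne y 0 with rfl | hy
      · exact le_rfl
      · exact (hsep 0 y hy).le
  · intro L c hL hc hc1
    have hlc : 0 < Real.log (1 / c) := Real.log_pos (by rw [lt_div_iff₀ hc]; linarith)
    -- As `log(1/c) ≤ log(1/(αΔ))/Δ²`, the additive `L` is absorbed at the cost of a factor `L /
    -- log(1/c)`.
    refine ⟨50000 * (1 + L / Real.log (1 / c)), by positivity, ?_⟩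
    intro 𝒳 _ P _ g sel α θ hg hsep hsel hα hα1 hθ hαc
    refine (ChangeDetection.worstDelay_le_log_add hL P hg hsep hsel hα hα1 hθ).trans
      (ENNReal.ofReal_le_ofReal ?_)
    have hΔ := ChangeDetection.gap_pos hsep hθ
    have hΔ1 := ChangeDetection.gap_le_one P (g := g) θ
    set Δ := ChangeDetection.gap P g θ
    have hℓ : Real.log (1 / c) ≤ Real.log (1 / (α * Δ)) :=
      Real.log_le_log (by positivity) (one_div_le_one_div_of_le (by positivity) hαc)
    have hℓΔ : Real.log (1 / c) ≤ Real.log (1 / (α * Δ)) / Δ ^ 2 := by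
      rw [le_div_iff₀ (by positivity)]
      have : Δ ^ 2 ≤ 1 := pow_le_one₀ hΔ.le hΔ1
      nlinarith
    have hLle : (L : ℝ) ≤ L / Real.log (1 / c) * (Real.log (1 / (α * Δ)) / Δ ^ 2) := by
      rw [div_mul_eq_mul_div, le_div_iff₀ hlc]
      gcongr
    linarith
  · intro L 𝒳 _ P _ g sel α θ hL hg hsep hsel hα hα1 hθ
    exact ChangeDetection.worstDelay_le_log_add hL P hg hsep hsel hα hα1 hθ
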